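/- Let $F$ be a field of characteristic $0$ and let $E$ be the Grassmann algebra of an $F$-vector space $L$ with countably infinite basis $e_1,e_2,\dots$. Let $a,b$ be positive integers and $c$ an integer with $-b<c<a$. Split the basis of $L$ into three infinite sets, assign to their elements the degrees $-b$, $c$ and $a$, respectively, and extend additively to monomials; this gives the $\mathbb Z$-grading $E_{(-b,c,a)}^{(\infty,\infty,\infty)}=\bigoplus_{r\in\mathbb Z}A_r$ on $E$. Assume that it is of full support, i.e. $A_r\neq 0$ for all $r\in\mathbb Z$. Then: (1) $E_{(-b,c,a)}^{(\infty,\infty,\infty)}$ is a $2$-central $\mathbb Z$-grading; that is, it is a $\mathbb Z$-grading in which every $e_i$ is homogeneous, it is of full support, and for each even $r$ the component $A_r$ contains infinitely many monomials $e_{i_1}\cdots e_{i_m}$ ($i_1<\dots<i_m$) of even length $m$ with pairwise disjoint supports $\{e_{i_1},\dots,e_{i_m}\}$. (2) $E_{(-b,c,a)}^{(\infty,\infty,\infty)}$ generates (i) the variety $\mathfrak V_{(-1,0,2)}$, if $abc$ is even; (ii) the variety $\mathfrak V_{can}$, if $abc$ is odd. Here, for a group $G$, $F\langle X|G\rangle$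 is the free unital associative $G$-graded algebra on variables $x_i^g$ of degree $g$ ($g\in G$, $i$ in a countably infinite index set), $T_G(A)$ denotes the ideal of $G$-graded polynomial identities of a $G$-graded algebra $A$, and $A$ generates the variety of $G$-graded algebras defined by a set $S\subseteq F\langle X|G\rangle$ if $T_G(A)$ is the $T_G$-ideal generated by $S$, i.e. the smallest two-sided ideal containing $S$ and invariant under all graded endomorphisms of $F\langle X|G\rangle$. $\mathfrak V_{can}$ is the variety of $\mathbb Z$-graded algebras defined by the polynomials $[x_1,x_2]$, whenever $\|x_1\|$ or $\|x_2\|$ is even, and $x_1x_2+x_2x_1$, whenever $\|x_1\|$ and $\|x_2\|$ are both odd. $\mathfrak V_{(-1,0,2)}$ is the variety of $\mathbb Z$-graded algebras defined by $\{f\in F\langle X|\mathbb Z\rangle\mid \pi_2(f)\in T_{\mathbb Z_2}(E_\infty)\}$, where $E_\infty$ is the $\mathbb Z_2$-grading on $E$ with $\|e_i\|=0$ for $i$ even and $\|e_i\|=1$ for $i$ odd, and $\pi_2\colon F\langle X|\mathbb Z\rangle\to F\langle X|\mathbb Z_2\rangle$ is the homomorphism of unital algebras reducing the degrees of the variables modulo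 $2$ and sending distinct variables to distinct variables: $\pi_2(x_i^g)=x_{\nu(g,i)}^{\overline g}$, where $\nu$ is any fixed numbering for which $(g,i)\mapsto(\overline g,\nu(g,i))$ is injective. -/

import Mathlib

noncomputable section

namespace GrassmannGrading

/-- The infinite dimensional Grassmann algebra `E` over `F`, i.e. the exterior algebra of a vector
space with a basis indexed by the natural numbers. -/
abbrev Grassmann (F : Type*) [Field F] : Type _ := ExteriorAlgebra F (ℕ →₀ F)

/-- The `i`-th generator `e_i`. -/
def gen (F : Type*) [Field F] (i : ℕ) : Grassmann F :=
  ExteriorAlgebra.ι F (Finsupp.single i 1)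

/-- The canonical basis element `e_{i_1} ⋯ e_{i_k}`, `i_1 < ⋯ < i_k`, with support
`s = {i_1, …, i_k}`; its length is the cardinality of `s`, and it is `1` for `s = ∅`. -/
def mono (F : Type*) [Field F] (s : Finset ℕ) : Grassmann F :=
  ((s.sort (· ≤ ·)).map (gen F)).prod

section Gradings

variable {F : Type*} [Field F] {A : Type*} [Ring A] [Algebra F A]

/-- The family `𝒜` of subspaces is a `G`-grading of the algebra `A`: the algebra is the direct sum
of the subspaces, `1 ∈ 𝒜 0` and `𝒜 g * 𝒜 h ⊆ 𝒜 (g + h)`. -/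
def IsGrading {G : Type*} [AddCommGroup G] [DecidableEq G] (𝒜 : G → Submodule F A) : Prop :=
  SetLike.GradedMonoid 𝒜 ∧ DirectSum.IsInternal 𝒜

/-- The support of the grading is the whole group. -/
def FullSupport {G : Type*} (𝒜 : G → Submodule F A) : Prop :=
  ∀ g : G, 𝒜 g ≠ ⊥

/-- The set `T_G(A)` of graded polynomial identities of `A`. The free `G`-graded algebra `F⟨X|G⟩`
is the free algebra on the variables `x_i^g`, encoded as pairs `(g, i)`. -/
def gradedIdentities {G : Type*} (𝒜 : G → Submodule F A) : Set (FreeAlgebra F (G × ℕ)) :=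
  {f | ∀ φ : G × ℕ → A, (∀ x : G × ℕ, φ x ∈ 𝒜 x.1) → FreeAlgebra.lift F φ f = 0}

end Gradings

section FreeGraded

variable (F : Type*) [Field F] {G : Type*} [AddCommGroup G]

/-- The component of degree `g` of `F⟨X|G⟩`: the span of the monomials of degree `g`. -/
def freeComponent (g : G) : Submodule F (FreeAlgebra F (G × ℕ)) :=
  Submodule.span F {f | ∃ l : List (G × ℕ), (l.map Prod.fst).sum = g ∧
    f = (l.map (FreeAlgebra.ι F)).prod}

/-- A two-sided ideal of `F⟨X|G⟩` is a `T_G`-ideal if all graded endomorphisms map it to itself. -/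
def IsTIdeal (I : TwoSidedIdeal (FreeAlgebra F (G × ℕ))) : Prop :=
  ∀ φ : FreeAlgebra F (G × ℕ) →ₐ[F] FreeAlgebra F (G × ℕ),
    (∀ g : G, ∀ f ∈ freeComponent F g, φ f ∈ freeComponent F g) → ∀ f ∈ I, φ f ∈ I

/-- The `T_G`-ideal generated by `S`, which is the ideal `T_G(𝔙)` of the variety `𝔙` of `G`-graded
algebras defined by the identities in `S`. -/
def tIdealGenerated (S : Set (FreeAlgebra F (G × ℕ))) : Set (FreeAlgebra F (G × ℕ)) :=
  {f | ∀ I : TwoSidedIdeal (FreeAlgebra F (G × ℕ)), IsTIdeal F I → (∀ s ∈ S, s ∈ I) → f ∈ I}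

/-- The graded algebra `A` generates the variety of `G`-graded algebras defined by the identities
in `S`, i.e. `T_G(A) = T_G(𝔙)`. -/
def GeneratesVariety {F : Type*} [Field F] {A : Type*} [Ring A] [Algebra F A]
    (𝒜 : G → Submodule F A) (S : Set (FreeAlgebra F (G × ℕ))) : Prop :=
  gradedIdentities 𝒜 = tIdealGenerated F S

end FreeGraded

section GrassmannGradings

/-- The component of degree `g` in the grading on `E` for which the generator `e_i` has
degree `δ i` and degrees of monomials are added up. -/
def component (F : Type*) [Field F] {G : Type*} [AddCommGroup G] (δ : ℕ → G) (g : G) :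
    Submodule F (Grassmann F) :=
  Submodule.span F {w | ∃ s : Finset ℕ, ∑ i ∈ s, δ i = g ∧ w = mono F s}

/-- The degree map `δ` on the generators induces a grading of type `E_{(r_1,…,r_n)}^{(v_1,…,v_n)}`,
`r_1 < ⋯ < r_n`: the generators have degrees among `r_1, …, r_n`, and exactly `v_j` of them have
degree `r_j`. -/
structure IsInduced {n : ℕ} (r : Fin n → ℤ) (v : Fin n → ℕ∞) (δ : ℕ → ℤ) : Prop where
  strictMono : StrictMono r
  mem_range : ∀ i : ℕ, ∃ j : Fin n, δ i = r j
  encard_eq : ∀ j : Fin n, {i : ℕ | δ i = r j}.encard = v j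

variable {F : Type*} [Field F]

/-- `𝒜` is an `H`-central `G`-grading on `E`. -/
structure IsCentralGrading {G : Type*} [AddCommGroup G] [DecidableEq G] (H : AddSubgroup G)
    (𝒜 : G → Submodule F (Grassmann F)) : Prop where
  isGrading : IsGrading 𝒜
  homogeneous : ∀ i : ℕ, ∃ g : G, gen F i ∈ 𝒜 g
  fullSupport : FullSupport 𝒜
  central : ∀ h ∈ H, ∃ W : Set (Finset ℕ), W.Infinite ∧ W.PairwiseDisjoint id ∧
    ∀ s ∈ W, Even s.card ∧ mono F s ∈ 𝒜 h

/-- A `d`-central `ℤ`-grading on `E`. -/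
def IsDCentral (d : ℤ) (𝒜 : ℤ → Submodule F (Grassmann F)) : Prop :=
  IsCentralGrading (AddSubgroup.zmultiples d) 𝒜

variable (F)

/-- The `ℤ/2`-grading `E_∞` on `E`. -/
def gradingInfty : ZMod 2 → Submodule F (Grassmann F) :=
  component F (fun i : ℕ => if Even i then (0 : ZMod 2) else 1)

/-- Reduction mod 2 of the degrees of the variables: `x_i^g ↦ x_{ν(g,i)}^{g mod 2}`, where `ν`
renumbers the variables. -/
def varModTwo (ν : ℤ × ℕ → ℕ) (x : ℤ × ℕ) : ZMod 2 × ℕ := ((x.1 : ZMod 2), ν x)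

/-- The homomorphism `π_2 : F⟨X|ℤ⟩ → F⟨X|ℤ/2⟩`, with the variables renumbered by `ν`. -/
def piTwo (ν : ℤ × ℕ → ℕ) : FreeAlgebra F (ℤ × ℕ) →ₐ[F] FreeAlgebra F (ZMod 2 × ℕ) :=
  FreeAlgebra.lift F (fun x => FreeAlgebra.ι F (varModTwo ν x))

/-- The identities defining the variety `𝔙_{(-1,0,2)}`. -/
def identitiesInfty (ν : ℤ × ℕ → ℕ) : Set (FreeAlgebra F (ℤ × ℕ)) :=
  {f | piTwo F ν f ∈ gradedIdentities (gradingInfty F)}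

/-- The identities defining the variety `𝔙_can`: the commutators `[x_1, x_2]` if one of the degrees
is even, and `x_1 x_2 + x_2 x_1` if both are odd. -/
def identitiesCan : Set (FreeAlgebra F (ℤ × ℕ)) :=
  {f | ∃ g h : ℤ, (Even g ∨ Even h) ∧
      f = FreeAlgebra.ι F (g, 1) * FreeAlgebra.ι F (h, 2)
        - FreeAlgebra.ι F (h, 2) * FreeAlgebra.ι F (g, 1)} ∪
  {f | ∃ g h : ℤ, (Odd g ∧ Odd h) ∧
      f = FreeAlgebra.ι F (g, 1) * FreeAlgebra.ι F (h, 2)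
        + FreeAlgebra.ι F (h, 2) * FreeAlgebra.ι F (g, 1)}

end GrassmannGradings

end GrassmannGrading

end

noncomputable section

namespace GrassmannGrading

open scoped DirectSum Polynomial TensorProduct

/-! ### Monomials, signs and the universal property of `E`. -/

section Monomials

variable {F : Type*} [Field F]

/-! Full support and infinite degree classes provide, in each even degree `r`, infinitely many
disjoint even monomials of degree `r`; this is 2-centrality. Sums of `n` of them are central
elements `z` with `z ^ (n + 1) = 0` and `z ^ n` regular on any prescribed finitely generated part of
`E`. Hence a polynomial over `E` that vanishes at all central elements of degree `r` is zero
(`polynomial_eq_zero_of_eval_central`). It follows that identities for the ℤ-grading persist for its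
reduction mod 2 (`gradedIdentities_subset_modTwo`).

If `abc` is even, infinitely many generators of each parity occur, so the reduction and `E_∞` embed
in each other and have the same identities. If `abc` is odd, all generators are odd and `E` is
supercommutative. Conversely, an identity vanishes in the free supercommutative algebra
(`superEval_eq_zero`), and so is a consequence of the supercommutation relations
(`mem_of_superEval_eq_zero`). -/

theorem gen_mul_self (i : ℕ) : gen F i * gen F i = 0 :=
  ExteriorAlgebra.ι_sq_zero _

theorem gen_mul_gen (i j : ℕ) : gen F i * gen F j = -(gen F j * gen F i) :=
  eq_neg_of_add_eq_zero_left (ExteriorAlgebra.ι_add_mul_swap _ _)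

variable (F) in
/-- The product of the generators with indices in the list `l`. -/
def genProd (l : List ℕ) : Grassmann F := (l.map (gen F)).prod

@[simp] theorem genProd_nil : genProd F [] = 1 := rfl

@[simp] theorem genProd_cons (i : ℕ) (l : List ℕ) :
    genProd F (i :: l) = gen F i * genProd F l := by simp [genProd]

theorem mono_eq_genProd (s : Finset ℕ) : mono F s = genProd F (s.sort (· ≤ ·)) := rfl

theorem gen_mul_genProd (i : ℕ) (l : List ℕ) :
    gen F i * genProd F l = (-1 : F) ^ l.length • (genProd F l * gen F i) := by
  induction l with
  | nil => simp
  | cons j l ih =>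
    rw [genProd_cons, ← mul_assoc, gen_mul_gen, neg_mul, mul_assoc, ih, List.length_cons, pow_succ]
    simp [mul_assoc]

theorem genProd_mul_genProd (l l' : List ℕ) :
    genProd F l * genProd F l' =
      (-1 : F) ^ (l.length * l'.length) • (genProd F l' * genProd F l) := by
  induction l with
  | nil => simp
  | cons i l ih =>
    rw [genProd_cons, mul_assoc, ih, mul_smul_comm, ← mul_assoc, gen_mul_genProd, smul_mul_assoc,
      smul_smul, mul_assoc, List.length_cons, Nat.succ_mul, pow_add]

/-- Knowing the product up to sign is enough for membership in subspaces and for vanishing, so the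
sign of the permutation is not tracked. -/
theorem genProd_perm {l l' : List ℕ} (h : l.Perm l') :
    genProd F l = genProd F l' ∨ genProd F l = -genProd F l' := by
  induction h with
  | nil => simp
  | cons i _ ih => rcases ih with ih | ih <;> simp [ih]
  | swap i j l => right; simp [← mul_assoc, gen_mul_gen j i]
  | trans _ _ ih ih' => rcases ih with ih | ih <;> rcases ih' with ih' | ih' <;> simp [ih, ih']

theorem gen_mul_mono_of_mem {i : ℕ} {s : Finset ℕ} (h : i ∈ s) : gen F i * mono F s = 0 := by
  have hp : (s.sort (· ≤ ·)).Perm (i :: (s.sort (· ≤ ·)).erase i) :=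
    List.perm_cons_erase (by simpa using h)
  rw [mono_eq_genProd]
  rcases genProd_perm (F := F) hp with h | h <;> rw [h] <;>
    simp [← mul_assoc, gen_mul_self]

theorem genProd_eq_or_neg_mono {l : List ℕ} {s : Finset ℕ} (hl : l.Nodup) (hs : l.toFinset = s) :
    genProd F l = mono F s ∨ genProd F l = -mono F s := by
  refine genProd_perm ?_
  rw [List.perm_ext_iff_of_nodup hl (Finset.sort_nodup _ _)]
  simp [← hs]

theorem gen_mul_mono_of_notMem {i : ℕ} {s : Finset ℕ} (h : i ∉ s) :
    gen F i * mono F s = mono F (insert i s) ∨ gen F i * mono F s = -mono F (insert i s) := by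
  rw [mono_eq_genProd s, ← genProd_cons]
  exact genProd_eq_or_neg_mono (by simp [h]) (by simp)

theorem adjoin_range_gen : Algebra.adjoin F (Set.range (gen F)) = ⊤ := by
  have h : Algebra.adjoin F (Set.range (ExteriorAlgebra.ι F (M := ℕ →₀ F))) = ⊤ :=
    CliffordAlgebra.adjoin_range_ι
  rw [eq_top_iff, ← h, Algebra.adjoin_le_iff]
  rintro _ ⟨v, rfl⟩
  induction v using Finsupp.induction_linear with
  | zero => simp
  | add f g hf hg => rw [map_add]; exact add_mem hf hg
  | single i c =>
    have : (Finsupp.single i c : ℕ →₀ F) = c • Finsupp.single i 1 := by simp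
    rw [this, map_smul]
    exact Subalgebra.smul_mem _ (Algebra.subset_adjoin (Set.mem_range_self i)) c

theorem algHom_ext_gen {A : Type*} [Semiring A] [Algebra F A] {α β : Grassmann F →ₐ[F] A}
    (h : ∀ i, α (gen F i) = β (gen F i)) : α = β :=
  AlgHom.ext_of_adjoin_eq_top adjoin_range_gen (by rintro _ ⟨i, rfl⟩; exact h i)

/-- Cross terms cancel in pairs. This turns the universal property of the exterior algebra into one
for sequences of images of the generators. -/
theorem linearCombination_mul_self {A : Type*} [Ring A] [Algebra F A] {t : ℕ → A}
    (hsq : ∀ i, t i * t i = 0) (hanti : ∀ i j, t i * t j = -(t j * t i)) (v : ℕ →₀ F) :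
    Finsupp.linearCombination F t v * Finsupp.linearCombination F t v = 0 := by
  have hcomm : ∀ (i : ℕ) (w : ℕ →₀ F), t i * Finsupp.linearCombination F t w =
      -(Finsupp.linearCombination F t w * t i) := by
    intro i w
    induction w using Finsupp.induction_linear with
    | zero => simp
    | add f g hf hg => rw [map_add, mul_add, add_mul, hf, hg, neg_add]
    | single j c => simp [hanti i j]
  induction v using Finsupp.induction_linear with
  | zero => simp
  | add f g hf hg =>
    have : Finsupp.linearCombination F t f * Finsupp.linearCombination F t g =
        -(Finsupp.linearCombination F t g * Finsupp.linearCombination F t f) := by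
      clear hf hg
      induction f using Finsupp.induction_linear with
      | zero => simp
      | add f f' hf hf' => rw [map_add, mul_add, add_mul, hf, hf', neg_add]
      | single j c => simp [hcomm]
    rw [map_add, mul_add, add_mul, add_mul, hf, hg, this]
    simp
  | single i c => simp [hsq]

/-- The algebra homomorphism out of the Grassmann algebra given by a sequence of anticommuting
elements with square zero. -/
def liftGen {A : Type*} [Ring A] [Algebra F A] (t : ℕ → A) (hsq : ∀ i, t i * t i = 0)
    (hanti : ∀ i j, t i * t j = -(t j * t i)) : Grassmann F →ₐ[F] A :=
  ExteriorAlgebra.lift F ⟨Finsupp.linearCombination F t, linearCombination_mul_self hsq hanti⟩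

@[simp] theorem liftGen_gen {A : Type*} [Ring A] [Algebra F A] (t : ℕ → A)
    (hsq : ∀ i, t i * t i = 0) (hanti : ∀ i j, t i * t j = -(t j * t i)) (i : ℕ) :
    liftGen t hsq hanti (gen F i) = t i := by
  simp only [liftGen, gen]
  rw [ExteriorAlgebra.lift_ι_apply]
  simp

end Monomials

/-! ### The grading induced by degrees of the generators. -/

section Component

variable {F : Type*} [Field F] {G : Type*} [AddCommGroup G] (δ : ℕ → G)

theorem mono_mem_component (s : Finset ℕ) : mono F s ∈ component F δ (∑ i ∈ s, δ i) :=
  Submodule.subset_span ⟨s, rfl, rfl⟩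

theorem one_mem_component : (1 : Grassmann F) ∈ component F δ 0 := by
  simpa [mono] using mono_mem_component (F := F) δ ∅

theorem gen_mem_component (i : ℕ) : gen F i ∈ component F δ (δ i) := by
  simpa [mono] using mono_mem_component (F := F) δ {i}

theorem gen_mul_mem_component (i : ℕ) {g : G} {u : Grassmann F} (hu : u ∈ component F δ g) :
    gen F i * u ∈ component F δ (δ i + g) := by
  induction hu using Submodule.span_induction with
  | zero => simp
  | add u v _ _ hu hv => rw [mul_add]; exact add_mem hu hv
  | smul c u _ hu => rw [mul_smul_comm]; exact Submodule.smul_mem _ c hu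
  | mem u hu =>
    obtain ⟨s, rfl, rfl⟩ := hu
    by_cases h : i ∈ s
    · rw [gen_mul_mono_of_mem h]; exact zero_mem _
    · have := mono_mem_component (F := F) δ (insert i s)
      rw [Finset.sum_insert h] at this
      rcases gen_mul_mono_of_notMem (F := F) h with h | h <;> rw [h]
      · exact this
      · exact neg_mem this

theorem genProd_mul_mem_component (l : List ℕ) {g : G} {u : Grassmann F}
    (hu : u ∈ component F δ g) : genProd F l * u ∈ component F δ ((l.map δ).sum + g) := by
  induction l with
  | nil => simpa
  | cons i l ih =>
    rw [genProd_cons, mul_assoc, List.map_cons, List.sum_cons, add_assoc]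
    exact gen_mul_mem_component δ i ih

theorem sum_map_sort (s : Finset ℕ) : ((s.sort (· ≤ ·)).map δ).sum = ∑ i ∈ s, δ i := by
  rw [← Multiset.sum_coe, ← Multiset.map_coe, Finset.sort_eq]
  rfl

instance component_gradedMonoid : SetLike.GradedMonoid (component F δ) where
  one_mem := one_mem_component δ
  mul_mem := by
    intro g h u v hu hv
    induction hu using Submodule.span_induction with
    | zero => simp
    | add u u' _ _ hu hv => rw [add_mul]; exact add_mem hu hv
    | smul c u _ hu => rw [smul_mul_assoc]; exact Submodule.smul_mem _ c hu
    | mem u hu =>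
      obtain ⟨s, rfl, rfl⟩ := hu
      rw [mono_eq_genProd, ← sum_map_sort]
      exact genProd_mul_mem_component δ _ hv

theorem genProd_mem_component (l : List ℕ) : genProd F l ∈ component F δ (l.map δ).sum :=
  SetLike.list_prod_map_mem_graded _ _ _ fun i _ => gen_mem_component δ i

theorem map_mem_component {B : Type*} [Ring B] [Algebra F B] (ℬ : G → Submodule F B)
    [SetLike.GradedMonoid ℬ] (α : Grassmann F →ₐ[F] B) (h : ∀ i, α (gen F i) ∈ ℬ (δ i))
    {g : G} {u : Grassmann F} (hu : u ∈ component F δ g) : α u ∈ ℬ g := by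
  induction hu using Submodule.span_induction with
  | zero => simp
  | add u v _ _ hu hv => rw [map_add]; exact add_mem hu hv
  | smul c u _ hu => rw [map_smul]; exact Submodule.smul_mem _ c hu
  | mem u hu =>
    obtain ⟨s, rfl, rfl⟩ := hu
    rw [mono, map_list_prod, List.map_map, ← sum_map_sort]
    exact SetLike.list_prod_map_mem_graded _ _ _ fun i _ => h i

variable [DecidableEq G]

variable (F) in
/-- The homomorphism splitting an element of the Grassmann algebra into its components. -/
def splitHom : Grassmann F →ₐ[F] ⨁ g, component F δ g :=
  liftGen (fun i => DirectSum.of (fun g => component F δ g) (δ i) ⟨gen F i, gen_mem_component δ i⟩)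
    (fun i => by
      rw [DirectSum.of_mul_of]
      exact DFinsupp.single_eq_zero.mpr (Subtype.ext (gen_mul_self i)))
    (fun i j => by
      rw [DirectSum.of_mul_of, DirectSum.of_mul_of, ← map_neg]
      exact DirectSum.of_eq_of_gradedMonoid_eq (Sigma.subtype_ext (add_comm _ _) (gen_mul_gen i j)))

theorem splitHom_genProd (l : List ℕ) :
    splitHom F δ (genProd F l) = DirectSum.of (fun g => component F δ g) (l.map δ).sum
      ⟨genProd F l, genProd_mem_component δ l⟩ := by
  induction l with
  | nil => exact map_one _
  | cons i l ih =>
    refine (congrArg _ (genProd_cons i l)).trans ?_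
    rw [map_mul, ih, splitHom, liftGen_gen, DirectSum.of_mul_of]
    exact DirectSum.of_eq_of_gradedMonoid_eq (Sigma.subtype_ext rfl (genProd_cons i l).symm)

theorem splitHom_apply (g : G) (u : component F δ g) :
    splitHom F δ u = DirectSum.of (fun g => component F δ g) g u := by
  obtain ⟨u, hu⟩ := u
  dsimp only
  induction hu using Submodule.span_induction with
  | zero => rw [map_zero]; exact (map_zero (DirectSum.of (fun g => component F δ g) g)).symm
  | add u v _ _ hu hv => rw [map_add, hu, hv, ← map_add]; rfl
  | smul c u hu' hu =>
    rw [map_smul, hu]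
    exact (map_smul (DirectSum.lof F G (fun g => component F δ g) g) c ⟨u, hu'⟩).symm
  | mem u hu =>
    obtain ⟨s, rfl, rfl⟩ := hu
    refine (splitHom_genProd δ (s.sort (· ≤ ·))).trans ?_
    exact DirectSum.of_eq_of_gradedMonoid_eq (Sigma.subtype_ext (sum_map_sort δ s) rfl)

/-- Directness comes from the universal property: `splitHom` is a two-sided inverse of the sum map,
so linear independence of monomials is not needed. -/
theorem isGrading_component : IsGrading (component F δ) := by
  refine ⟨inferInstance, ?_⟩
  let _ : GradedAlgebra (component F δ) := GradedAlgebra.ofAlgHom _ (splitHom F δ)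
    (algHom_ext_gen fun i => by
      rw [AlgHom.comp_apply, splitHom, liftGen_gen, DirectSum.coeAlgHom_of]; rfl)
    (splitHom_apply δ)
  exact DirectSum.Decomposition.isInternal _

end Component

/-! ### Monomials in fresh generators are regular. -/

section Regular

variable {F : Type*} [Field F]

variable (F) in
/-- The subalgebra generated by the generators with indices in `T`. -/
def genSubalgebra (T : Finset ℕ) : Subalgebra F (Grassmann F) := Algebra.adjoin F (gen F '' T)

theorem genSubalgebra_mono {T T' : Finset ℕ} (h : T ⊆ T') :
    genSubalgebra F T ≤ genSubalgebra F T' :=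
  Algebra.adjoin_mono (Set.image_mono (by exact_mod_cast h))

theorem gen_mem_genSubalgebra {T : Finset ℕ} {i : ℕ} (h : i ∈ T) : gen F i ∈ genSubalgebra F T :=
  Algebra.subset_adjoin ⟨i, h, rfl⟩

theorem genProd_mem_genSubalgebra {T : Finset ℕ} {l : List ℕ} (h : ∀ i ∈ l, i ∈ T) :
    genProd F l ∈ genSubalgebra F T :=
  list_prod_mem fun x hx => by
    obtain ⟨i, hi, rfl⟩ := List.mem_map.1 hx
    exact gen_mem_genSubalgebra (h i hi)

theorem exists_mem_genSubalgebra (u : Grassmann F) : ∃ T, u ∈ genSubalgebra F T := by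
  have hu : u ∈ Algebra.adjoin F (Set.range (gen F)) := by rw [adjoin_range_gen]; trivial
  induction hu using Algebra.adjoin_induction with
  | mem u hu =>
    obtain ⟨i, rfl⟩ := hu
    exact ⟨{i}, gen_mem_genSubalgebra (by simp)⟩
  | algebraMap c => exact ⟨∅, algebraMap_mem _ c⟩
  | add u v _ _ hu hv =>
    obtain ⟨T, hT⟩ := hu
    obtain ⟨T', hT'⟩ := hv
    exact ⟨T ∪ T', add_mem (genSubalgebra_mono Finset.subset_union_left hT)
      (genSubalgebra_mono Finset.subset_union_right hT')⟩
  | mul u v _ _ hu hv =>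
    obtain ⟨T, hT⟩ := hu
    obtain ⟨T', hT'⟩ := hv
    exact ⟨T ∪ T', mul_mem (genSubalgebra_mono Finset.subset_union_left hT)
      (genSubalgebra_mono Finset.subset_union_right hT')⟩

/-- Contraction with the `j`-th coordinate functional is an antiderivation killing every generator
except `e_j`. The induction is on right multiplication, with an arbitrary left factor already
killed. -/
theorem contractRight_eq_zero {T : Finset ℕ} {j : ℕ} (hj : j ∉ T) {u : Grassmann F}
    (hu : u ∈ genSubalgebra F T) :
    CliffordAlgebra.contractRight u (Finsupp.lapply j : (ℕ →₀ F) →ₗ[F] F) = 0 := by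
  have key : ∀ v ∈ genSubalgebra F T, ∀ w : Grassmann F,
      CliffordAlgebra.contractRight w (Finsupp.lapply j : (ℕ →₀ F) →ₗ[F] F) = 0 →
      CliffordAlgebra.contractRight (w * v) (Finsupp.lapply j : (ℕ →₀ F) →ₗ[F] F) = 0 := by
    intro v hv
    induction hv using Algebra.adjoin_induction with
    | mem v hv =>
      obtain ⟨i, hi, rfl⟩ := hv
      intro w hw
      have hij : i ≠ j := by rintro rfl; exact hj hi
      have := CliffordAlgebra.contractRight_mul_ι (Q := (0 : QuadraticForm F (ℕ →₀ F)))
        (Finsupp.lapply j) (Finsupp.single i 1) w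
      refine this.trans ?_
      rw [hw]
      simp [hij]
    | algebraMap c =>
      intro w hw
      refine (CliffordAlgebra.contractRight_mul_algebraMap _ _ _).trans ?_
      rw [hw, zero_mul]
    | add u v _ _ hu hv =>
      intro w hw
      rw [mul_add, map_add, LinearMap.add_apply, hu w hw, hv w hw, add_zero]
    | mul u v _ _ hu hv =>
      intro w hw
      rw [← mul_assoc]
      exact hv _ (hu _ hw)
  simpa using key u hu 1 (CliffordAlgebra.contractRight_one _ _)

/-- Contracting `u * e_j` by the `j`-th coordinate recovers `u`. -/
theorem eq_zero_of_mul_gen_eq_zero {T : Finset ℕ} {j : ℕ} (hj : j ∉ T) {u : Grassmann F}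
    (hu : u ∈ genSubalgebra F T) (h : u * gen F j = 0) : u = 0 := by
  have := CliffordAlgebra.contractRight_mul_ι (Q := (0 : QuadraticForm F (ℕ →₀ F)))
        (Finsupp.lapply j) (Finsupp.single j 1) u
  rw [contractRight_eq_zero hj hu] at this
  have h0 : CliffordAlgebra.contractRight (u * gen F j)
      (Finsupp.lapply j : (ℕ →₀ F) →ₗ[F] F) = 0 := by
    rw [h]; simp
  have h1 := this.symm.trans h0
  simpa using h1

theorem eq_zero_of_mul_genProd_eq_zero {l : List ℕ} (hl : l.Nodup) {T : Finset ℕ}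
    (hT : ∀ i ∈ l, i ∉ T) {u : Grassmann F} (hu : u ∈ genSubalgebra F T)
    (h : u * genProd F l = 0) : u = 0 := by
  induction l generalizing T u with
  | nil => simpa using h
  | cons i l ih =>
    rw [List.nodup_cons] at hl
    rw [genProd_cons, ← mul_assoc] at h
    refine eq_zero_of_mul_gen_eq_zero (hT i (by simp)) hu (ih hl.2 (T := insert i T) ?_ ?_ h)
    · intro k hk
      have := hT k (by simp [hk])
      rw [Finset.mem_insert, not_or]
      exact ⟨fun hki => hl.1 (hki ▸ hk), this⟩
    · exact mul_mem (genSubalgebra_mono (Finset.subset_insert _ _) hu)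
        (gen_mem_genSubalgebra (by simp))

theorem eq_zero_of_mul_mono_eq_zero {s T : Finset ℕ} (hs : Disjoint s T) {u : Grassmann F}
    (hu : u ∈ genSubalgebra F T) (h : u * mono F s = 0) : u = 0 :=
  eq_zero_of_mul_genProd_eq_zero (Finset.sort_nodup _ _)
    (fun i hi => Finset.disjoint_left.1 hs (by simpa using hi)) hu h

theorem commute_mono_of_even {s : Finset ℕ} (hs : Even s.card) (u : Grassmann F) :
    Commute u (mono F s) := by
  have hu : u ∈ Algebra.adjoin F (Set.range (gen F)) := by rw [adjoin_range_gen]; trivial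
  induction hu using Algebra.adjoin_induction with
  | mem v hv =>
    obtain ⟨i, rfl⟩ := hv
    rw [Commute, SemiconjBy, mono_eq_genProd, gen_mul_genProd, Finset.length_sort, hs.neg_one_pow,
      one_smul]
  | algebraMap c => exact Algebra.commutes c _
  | add u v _ _ hu hv => exact hu.add_left hv
  | mul u v _ _ hu hv => exact hu.mul_left hv

end Regular

/-! ### Fresh copies of monomials and 2-centrality. -/

section Fresh

variable {F : Type*} [Field F] {δ : ℕ → ℤ}

/-- Each generator can be exchanged for an unused one of the same degree, since degree classes are
infinite. -/
theorem exists_disjoint_sum_eq (hinf : ∀ i, {j | δ j = δ i}.Infinite) (T s : Finset ℕ) :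
    ∃ t : Finset ℕ, Disjoint t T ∧ t.card = s.card ∧ ∑ i ∈ t, δ i = ∑ i ∈ s, δ i := by
  induction s using Finset.induction_on with
  | empty => exact ⟨∅, by simp⟩
  | insert i s hi ih =>
    obtain ⟨t, htT, hc, hsum⟩ := ih
    obtain ⟨j, hj, hj'⟩ := (hinf i).exists_notMem_finset (t ∪ T)
    rw [Finset.mem_union, not_or] at hj'
    refine ⟨insert j t, Finset.disjoint_insert_left.2 ⟨hj'.2, htT⟩, ?_, ?_⟩
    · rw [Finset.card_insert_of_notMem hi, Finset.card_insert_of_notMem hj'.1, hc]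
    · rw [Finset.sum_insert hi, Finset.sum_insert hj'.1, hsum, hj]

theorem exists_sum_eq (hfull : FullSupport (component F δ)) (r : ℤ) :
    ∃ s : Finset ℕ, ∑ i ∈ s, δ i = r := by
  by_contra! h
  refine hfull r (Submodule.span_eq_bot.2 ?_)
  rintro _ ⟨s, hs, -⟩
  exact absurd hs (h s)

theorem exists_even_disjoint_sum_eq (hinf : ∀ i, {j | δ j = δ i}.Infinite)
    (hfull : FullSupport (component F δ)) (T : Finset ℕ) {r : ℤ} (hr : Even r) :
    ∃ s : Finset ℕ, Disjoint s T ∧ s.Nonempty ∧ Even s.card ∧ ∑ i ∈ s, δ i = r := by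
  obtain ⟨q, rfl⟩ := hr
  -- Writing `q = 1 + (q - 1)` forces a nonempty support even when `q = 0`.
  obtain ⟨s₁, h₁⟩ := exists_sum_eq hfull 1
  obtain ⟨s₂, h₂⟩ := exists_sum_eq hfull (q - 1)
  obtain ⟨t₂, hd, -, ht₂⟩ := exists_disjoint_sum_eq hinf s₁ s₂
  have hne : s₁.Nonempty := by
    rw [Finset.nonempty_iff_ne_empty]
    rintro rfl
    simp at h₁
  have hsum : ∑ i ∈ t₂ ∪ s₁, δ i = q := by
    rw [Finset.sum_union hd, ht₂, h₁, h₂, sub_add_cancel]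
  -- Two disjoint copies of a support of degree `q` have total degree `q + q` and even total length.
  obtain ⟨u, hu, huc, hus⟩ := exists_disjoint_sum_eq hinf T (t₂ ∪ s₁)
  obtain ⟨v, hv, hvc, hvs⟩ := exists_disjoint_sum_eq hinf (T ∪ u) (t₂ ∪ s₁)
  rw [Finset.disjoint_union_right] at hv
  refine ⟨u ∪ v, Finset.disjoint_union_left.2 ⟨hu, hv.1⟩, ?_, ?_, ?_⟩
  · refine Finset.Nonempty.inl (Finset.card_pos.1 ?_)
    rw [huc]
    exact Finset.card_pos.2 hne.inr
  · rw [Finset.card_union_of_disjoint hv.2.symm, huc, hvc]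
    exact ⟨_, rfl⟩
  · rw [Finset.sum_union hv.2.symm, hus, hvs, hsum]

theorem isDCentral_two_component (hinf : ∀ i, {j | δ j = δ i}.Infinite)
    (hfull : FullSupport (component F δ)) : IsDCentral 2 (component F δ) where
  isGrading := isGrading_component δ
  homogeneous i := ⟨δ i, gen_mem_component δ i⟩
  fullSupport := hfull
  central h hh := by
    have hh : Even h := by
      obtain ⟨k, rfl⟩ := AddSubgroup.mem_zmultiples_iff.1 hh
      simp
    obtain ⟨f, hf, hd⟩ := exists_seq_of_forall_finset_exists'
      (fun s : Finset ℕ => s.Nonempty ∧ Even s.card ∧ ∑ i ∈ s, δ i = h) Disjoint (fun S _ => by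
        obtain ⟨s, hs, hs'⟩ := exists_even_disjoint_sum_eq hinf hfull (S.sup id) hh
        exact ⟨s, hs', fun x hx => (Finset.disjoint_sup_right.1 hs hx).symm⟩)
    have hinj : Function.Injective f := fun m n hmn => by
      by_contra hne
      have := hd hne
      rw [Function.onFun, hmn, disjoint_self] at this
      exact (hf n).1.ne_empty this
    refine ⟨Set.range f, Set.infinite_range_of_injective hinj, ?_, ?_⟩
    · rintro _ ⟨m, rfl⟩ _ ⟨n, rfl⟩ hmn
      exact hd fun h => hmn (congrArg f h)
    · rintro _ ⟨n, rfl⟩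
      exact ⟨(hf n).2.1, (hf n).2.2 ▸ mono_mem_component δ _⟩

end Fresh

/-! ### Graded identities form a `T`-ideal. -/

section TIdeal

variable {F : Type*} [Field F] {A : Type*} [Ring A] [Algebra F A] {G : Type*}

/-- The graded identities of an algebra, as a two-sided ideal. -/
def identityIdeal (𝒜 : G → Submodule F A) : TwoSidedIdeal (FreeAlgebra F (G × ℕ)) :=
  TwoSidedIdeal.mk' (gradedIdentities 𝒜)
    (fun φ _ => map_zero _)
    (fun hf hg φ hφ => by rw [map_add, hf φ hφ, hg φ hφ, add_zero])
    (fun hf φ hφ => by rw [map_neg, hf φ hφ, neg_zero])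
    (fun hf φ hφ => by rw [map_mul, hf φ hφ, mul_zero])
    (fun hf φ hφ => by rw [map_mul, hf φ hφ, zero_mul])

theorem mem_identityIdeal {𝒜 : G → Submodule F A} {f : FreeAlgebra F (G × ℕ)} :
    f ∈ identityIdeal 𝒜 ↔ f ∈ gradedIdentities 𝒜 :=
  TwoSidedIdeal.mem_mk' _ _ _ _ _ _ _

variable [AddCommGroup G]

theorem map_freeComponent_mem (𝒜 : G → Submodule F A) [SetLike.GradedMonoid 𝒜]
    (α : FreeAlgebra F (G × ℕ) →ₐ[F] A) (h : ∀ x, α (FreeAlgebra.ι F x) ∈ 𝒜 x.1) {g : G}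
    {f : FreeAlgebra F (G × ℕ)} (hf : f ∈ freeComponent F g) : α f ∈ 𝒜 g := by
  induction hf using Submodule.span_induction with
  | zero => simp
  | add u v _ _ hu hv => rw [map_add]; exact add_mem hu hv
  | smul c u _ hu => rw [map_smul]; exact Submodule.smul_mem _ c hu
  | mem u hu =>
    obtain ⟨l, rfl, rfl⟩ := hu
    rw [map_list_prod, List.map_map]
    exact SetLike.list_prod_map_mem_graded _ _ _ fun i _ => h i

theorem ι_mem_freeComponent (x : G × ℕ) : FreeAlgebra.ι F x ∈ freeComponent F x.1 :=
  Submodule.subset_span ⟨[x], by simp, by simp⟩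

theorem isTIdeal_identityIdeal (𝒜 : G → Submodule F A) [SetLike.GradedMonoid 𝒜] :
    IsTIdeal F (identityIdeal 𝒜) := by
  intro α hα f hf
  rw [mem_identityIdeal] at hf ⊢
  intro φ hφ
  have h := hf (fun x => FreeAlgebra.lift F φ (α (FreeAlgebra.ι F x))) fun x =>
    map_freeComponent_mem 𝒜 (FreeAlgebra.lift F φ) (by simpa using hφ)
      (hα _ _ (ι_mem_freeComponent x))
  have heq : FreeAlgebra.lift F (fun x => FreeAlgebra.lift F φ (α (FreeAlgebra.ι F x))) =
      (FreeAlgebra.lift F φ).comp α := by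
    ext x
    simp
  rwa [heq] at h

theorem tIdealGenerated_subset (𝒜 : G → Submodule F A) [SetLike.GradedMonoid 𝒜]
    {S : Set (FreeAlgebra F (G × ℕ))} (hS : S ⊆ gradedIdentities 𝒜) :
    tIdealGenerated F S ⊆ gradedIdentities 𝒜 := fun _ hf =>
  mem_identityIdeal.1 (hf _ (isTIdeal_identityIdeal 𝒜) fun _ hs => mem_identityIdeal.2 (hS hs))

end TIdeal

/-! ### Passing identities to the grading mod 2. -/

section Coarsening

variable {F : Type*} [Field F] [CharZero F] {δ : ℕ → ℤ}

theorem add_pow_succ_of_mul_self_eq_zero {R : Type*} [Ring R] {z w : R} (h : Commute z w)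
    (hw : w * w = 0) (n : ℕ) : (z + w) ^ (n + 1) = z ^ (n + 1) + (n + 1 : ℕ) • (z ^ n * w) := by
  induction n with
  | zero => simp
  | succ n ih =>
    have h1 : z ^ n * w * z = z ^ (n + 1) * w := by
      rw [mul_assoc, ← h.eq, ← mul_assoc, ← pow_succ]
    have h2 : z ^ n * w * w = 0 := by rw [mul_assoc, hw, mul_zero]
    rw [pow_succ, ih, mul_add, add_mul, add_mul, smul_mul_assoc, smul_mul_assoc, h1, h2, smul_zero,
      add_zero, ← pow_succ, succ_nsmul _ (n + 1)]
    abel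

/-- Take `z = w₁ + ⋯ + wₙ` with disjoint even monomials of degree `r` avoiding `T`. Then `z ^ n = n!
w₁ ⋯ wₙ`, which is regular on the subalgebra of `T` because `n!` is invertible in characteristic 0.
-/
theorem exists_central_nilpotent (hinf : ∀ i, {j | δ j = δ i}.Infinite)
    (hfull : FullSupport (component F δ)) {r : ℤ} (hr : Even r) (T : Finset ℕ) (n : ℕ) :
    ∃ z ∈ component F δ r, (∀ u, Commute u z) ∧ z ^ (n + 1) = 0 ∧
      ∀ u ∈ genSubalgebra F T, u * z ^ n = 0 → u = 0 := by
  -- The induction also records a finite set `T'` of generators containing `T` and those in `z`, so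
  -- that the next monomial can avoid it.
  suffices H : ∃ z ∈ component F δ r, (∀ u, Commute u z) ∧ z ^ (n + 1) = 0 ∧
      (∀ u ∈ genSubalgebra F T, u * z ^ n = 0 → u = 0) ∧
      ∃ T', T ⊆ T' ∧ z ∈ genSubalgebra F T' by
    obtain ⟨z, h1, h2, h3, h4, -⟩ := H
    exact ⟨z, h1, h2, h3, h4⟩
  induction n with
  | zero =>
    exact ⟨0, zero_mem _, fun u => Commute.zero_right u, by simp, by simp, T, subset_rfl,
      zero_mem _⟩
  | succ n ih =>
    obtain ⟨z, hz, hc, hnil, hreg, T', hT, hzT⟩ := ih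
    obtain ⟨s, hs, ⟨i, hi⟩, heven, rfl⟩ := exists_even_disjoint_sum_eq hinf hfull T' hr
    have hw : mono F s * mono F s = 0 := by
      have hp : (s.sort (· ≤ ·)).Perm (i :: (s.sort (· ≤ ·)).erase i) :=
        List.perm_cons_erase (by simpa using hi)
      have h0 : genProd F (i :: (s.sort (· ≤ ·)).erase i) * mono F s = 0 := by
        rw [genProd_cons, mul_assoc, (commute_mono_of_even heven _).eq, ← mul_assoc,
          gen_mul_mono_of_mem hi, zero_mul]
      rcases genProd_perm (F := F) hp with h | h <;> rw [← mono_eq_genProd] at h <;>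
        nth_rewrite 1 [h]
      · exact h0
      · rw [neg_mul, h0, neg_zero]
    have hcw : Commute z (mono F s) := commute_mono_of_even heven z
    refine ⟨z + mono F s, add_mem hz (mono_mem_component δ s),
      fun u => (hc u).add_right (commute_mono_of_even heven u), ?_, ?_, T' ∪ s,
      hT.trans Finset.subset_union_left, add_mem
        (genSubalgebra_mono Finset.subset_union_left hzT)
        (genProd_mem_genSubalgebra fun i hi => by simp at hi; simp [hi])⟩
    · rw [add_pow_succ_of_mul_self_eq_zero hcw hw, pow_succ, hnil]
      simp
    · intro u hu h
      rw [add_pow_succ_of_mul_self_eq_zero hcw hw, hnil, zero_add, mul_smul_comm, ← mul_assoc,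
        ← Nat.cast_smul_eq_nsmul F, smul_eq_zero] at h
      have h := h.resolve_left (by exact_mod_cast n.succ_ne_zero)
      exact hreg u hu (eq_zero_of_mul_mono_eq_zero hs
        (mul_mem (genSubalgebra_mono hT hu) (pow_mem hzT n)) h)

/-- With `n` the degree and `m` the lowest exponent of `p`, multiplying `p(z)` by `z ^ (n - m)`
leaves only `p_m z ^ n`, as `z ^ (n + 1) = 0`. Regularity of `z ^ n` then kills `p_m`. -/
theorem polynomial_eq_zero_of_eval_central (hinf : ∀ i, {j | δ j = δ i}.Infinite)
    (hfull : FullSupport (component F δ)) {r : ℤ} (hr : Even r) {p : (Grassmann F)[X]}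
    (h : ∀ z ∈ component F δ r, (∀ u, Commute u z) → p.eval z = 0) : p = 0 := by
  choose T hT using fun u : Grassmann F => exists_mem_genSubalgebra u
  obtain ⟨z, hz, hc, hnil, hreg⟩ := exists_central_nilpotent hinf hfull hr
    ((Finset.range (p.natDegree + 1)).sup fun k => T (p.coeff k)) p.natDegree
  by_contra hp
  set m := p.natTrailingDegree with hm
  have hmn : m ≤ p.natDegree := Polynomial.natTrailingDegree_le_natDegree p
  have hlead : p.coeff m ≠ 0 :=
    mt Polynomial.trailingCoeff_eq_zero.1 hp
  have hsum : p.coeff m * z ^ p.natDegree = p.eval z * z ^ (p.natDegree - m) := by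
    rw [Polynomial.eval_eq_sum_range, Finset.sum_mul, Finset.sum_eq_single m]
    · rw [mul_assoc, ← pow_add, Nat.add_sub_cancel' hmn]
    · intro k _ hkm
      rcases lt_or_gt_of_ne hkm with hk | hk
      · rw [Polynomial.coeff_eq_zero_of_lt_natTrailingDegree hk, zero_mul, zero_mul]
      · rw [mul_assoc, ← pow_add, pow_eq_zero_of_le (by omega) hnil, mul_zero]
    · intro hk
      exact absurd (Finset.mem_range.2 (by omega)) hk
  rw [h z hz hc, zero_mul] at hsum
  refine hlead (hreg _ (genSubalgebra_mono ?_ (hT _)) hsum)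
  exact Finset.le_sup (f := fun k => T (p.coeff k)) (Finset.mem_range.2 (by omega))

/-- If `f` vanishes on a family of subspaces stable under multiplication by the component of even
degree `r`, then it vanishes on the sums of the translates of these subspaces by multiples
of `r`. -/
theorem lift_eq_zero_of_iSup (hinf : ∀ i, {j | δ j = δ i}.Infinite)
    (hfull : FullSupport (component F δ)) {r : ℤ} (hr : Even r)
    {D : ℤ → Submodule F (Grassmann F)}
    (hD : ∀ g, ∀ u ∈ D g, ∀ z ∈ component F δ r, u * z ∈ D (g + r))
    {f : FreeAlgebra F (ℤ × ℕ)} (hf : f ∈ gradedIdentities D) :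
    f ∈ gradedIdentities fun g => ⨆ k : ℕ, D (g - k * r) := by
  intro φ hφ
  -- The summands of `φ x` become coefficients of a polynomial with value `φ x` at 1, while at a
  -- central `z` of degree `r` its value lies in `D x.1`.
  have hex : ∀ x : ℤ × ℕ, ∃ q : (Grassmann F)[X], (∀ k : ℕ, q.coeff k ∈ D (x.1 - k * r)) ∧
      q.eval 1 = φ x := by
    intro x
    refine Submodule.iSup_induction (fun k : ℕ => D (x.1 - k * r))
      (motive := fun u => ∃ q : (Grassmann F)[X], (∀ k : ℕ, q.coeff k ∈ D (x.1 - k * r)) ∧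
        q.eval 1 = u) (hφ x) ?_ ?_ ?_
    · intro k u hu
      refine ⟨Polynomial.monomial k u, fun j => ?_, by simp⟩
      rw [Polynomial.coeff_monomial]
      split_ifs with h
      · exact h ▸ hu
      · exact zero_mem _
    · exact ⟨0, by simp, by simp⟩
    · rintro u v ⟨p, hp, rfl⟩ ⟨q, hq, rfl⟩
      exact ⟨p + q, fun k => by rw [Polynomial.coeff_add]; exact add_mem (hp k) (hq k), by simp⟩
  choose q hq hq1 using hex
  -- Evaluation over a noncommutative ring is multiplicative here because `z` is central.
  have hcomm : ∀ z : Grassmann F, (∀ u, Commute u z) →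
      (FreeAlgebra.lift F q f).eval z = FreeAlgebra.lift F (fun x => (q x).eval z) f := by
    intro z hz
    clear hf
    induction f with
    | grade0 c =>
      rw [AlgHom.commutes, AlgHom.commutes, Polynomial.algebraMap_apply, Polynomial.eval_C]
    | grade1 x => rw [FreeAlgebra.lift_ι_apply, FreeAlgebra.lift_ι_apply]
    | mul f g hf hg =>
      rw [map_mul, map_mul, ← hf, ← hg]
      exact Polynomial.eval₂_mul_noncomm _ _ fun k => hz _
    | add f g hf hg => rw [map_add, map_add, ← hf, ← hg, Polynomial.eval_add]
  have hzero : FreeAlgebra.lift F q f = 0 := by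
    refine polynomial_eq_zero_of_eval_central hinf hfull hr fun z hz hc => ?_
    rw [hcomm z hc]
    refine hf _ fun x => ?_
    rw [Polynomial.eval_eq_sum_range]
    refine Submodule.sum_mem _ fun k _ => ?_
    have hpow : ∀ (k : ℕ) (g : ℤ), ∀ u ∈ D (g - k * r), u * z ^ k ∈ D g := by
      intro k
      induction k with
      | zero => intro g u hu; simpa using hu
      | succ k ih =>
        intro g u hu
        rw [pow_succ', ← mul_assoc]
        refine ih g _ ?_
        have := hD _ u hu z hz
        rwa [show g - ((k + 1 : ℕ) : ℤ) * r + r = g - k * r by push_cast; ring] at this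
    exact hpow k _ _ (hq x k)
  have h1 := hcomm 1 Commute.one_right
  simp only [hzero, Polynomial.eval_zero, hq1] at h1
  exact h1.symm

/-- Only nonnegative multiples of `r` are reached at a time, so the coarsening is done for `r = 2`
and then for `r = -2`. -/
theorem gradedIdentities_subset_modTwo (hinf : ∀ i, {j | δ j = δ i}.Infinite)
    (hfull : FullSupport (component F δ)) {f : FreeAlgebra F (ℤ × ℕ)}
    (hf : f ∈ gradedIdentities (component F δ)) {φ : ℤ × ℕ → Grassmann F}
    (hφ : ∀ x, φ x ∈ component F (fun i => (δ i : ZMod 2)) (x.1 : ZMod 2)) :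
    FreeAlgebra.lift F φ f = 0 := by
  have h1 := lift_eq_zero_of_iSup hinf hfull (r := 2) (by decide)
    (fun g u hu z hz => SetLike.mul_mem_graded hu hz) hf
  have h2 := lift_eq_zero_of_iSup hinf hfull (r := -2) (by decide) (fun g u hu z hz => ?_) h1
  · refine h2 φ fun x => ?_
    refine Submodule.span_le.2 ?_ (hφ x)
    rintro _ ⟨s, hs, rfl⟩
    have hdvd : (2 : ℤ) ∣ x.1 - ∑ i ∈ s, δ i := by
      refine (ZMod.intCast_eq_intCast_iff_dvd_sub _ _ 2).1 ?_
      rw [← hs]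
      push_cast
      rfl
    obtain ⟨j, hj⟩ := hdvd
    have hmem := mono_mem_component (F := F) δ s
    -- The shift `2 * j` is split into its negative and positive parts, one for each coarsening.
    refine Submodule.mem_iSup_of_mem (-j).toNat (Submodule.mem_iSup_of_mem j.toNat ?_)
    rwa [show x.1 - ((-j).toNat : ℤ) * -2 - (j.toNat : ℤ) * 2 = ∑ i ∈ s, δ i by omega]
  · refine Submodule.iSup_induction (fun k : ℕ => component F δ (g - k * 2))
      (motive := fun u => u * z ∈ ⨆ k : ℕ, component F δ (g + -2 - k * 2)) hu ?_ ?_ ?_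
    · intro k u hu
      refine Submodule.mem_iSup_of_mem k ?_
      rw [show g + -2 - (k : ℤ) * 2 = g - k * 2 + -2 by ring]
      exact SetLike.mul_mem_graded hu hz
    · simp
    · intro u v hu hv
      rw [add_mul]
      exact add_mem hu hv

end Coarsening

/-! ### Even product: comparison with `E_∞`. -/

section EvenProduct

variable {F : Type*} [Field F] {δ : ℕ → ℤ}

theorem exists_injective_map_mem_component {G : Type*} [AddCommGroup G] {δ δ' : ℕ → G} {τ : ℕ → ℕ}
    (hτ : Function.Injective τ) (hδ : ∀ i, δ' (τ i) = δ i) :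
    ∃ α : Grassmann F →ₐ[F] Grassmann F, Function.Injective α ∧
      ∀ g, ∀ u ∈ component F δ g, α u ∈ component F δ' g := by
  refine ⟨ExteriorAlgebra.map (Finsupp.lmapDomain F F τ), ExteriorAlgebra.map_injective_field
    (LinearMap.ker_eq_bot.2 (Finsupp.mapDomain_injective hτ)), fun g u hu =>
    map_mem_component δ (component F δ') _ (fun i => ?_) hu⟩
  have : ExteriorAlgebra.map (Finsupp.lmapDomain F F τ) (gen F i) = gen F (τ i) := by
    rw [gen, ExteriorAlgebra.map_apply_ι, Finsupp.lmapDomain_apply, Finsupp.mapDomain_single, gen]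
  rw [this, ← hδ]
  exact gen_mem_component δ' (τ i)

theorem exists_injective_parity {δ δ' : ℕ → ZMod 2} (h0 : {i | δ' i = 0}.Infinite)
    (h1 : {i | δ' i = 1}.Infinite) : ∃ τ : ℕ → ℕ, Function.Injective τ ∧ ∀ i, δ' (τ i) = δ i := by
  have key : ∀ z : ZMod 2, z = 0 ∨ z = 1 := by decide
  have hinf : ∀ z : ZMod 2, {i | δ' i = z}.Infinite := fun z => by
    rcases key z with rfl | rfl <;> assumption
  have hspec : ∀ i, δ' ((hinf (δ i)).natEmbedding _ i) = δ i := fun i =>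
    ((hinf (δ i)).natEmbedding _ i).2
  refine ⟨fun i => (hinf (δ i)).natEmbedding _ i, fun i j hij => ?_, hspec⟩
  dsimp only at hij
  have hδ : δ i = δ j := by rw [← hspec i, ← hspec j, hij]
  rw [hδ] at hij
  exact ((hinf (δ j)).natEmbedding _).injective (Subtype.ext hij)

theorem exists_injective_algHom_parity {δ δ' : ℕ → ZMod 2} (h0 : {i | δ' i = 0}.Infinite)
    (h1 : {i | δ' i = 1}.Infinite) : ∃ α : Grassmann F →ₐ[F] Grassmann F, Function.Injective α ∧
      ∀ g, ∀ u ∈ component F δ g, α u ∈ component F δ' g :=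
  let ⟨_, hτ, hδ⟩ := exists_injective_parity (δ := δ) h0 h1
  exists_injective_map_mem_component hτ hδ

theorem lift_piTwo (ν : ℤ × ℕ → ℕ) (θ : ZMod 2 × ℕ → Grassmann F) (f : FreeAlgebra F (ℤ × ℕ)) :
    FreeAlgebra.lift F θ (piTwo F ν f) = FreeAlgebra.lift F (θ ∘ varModTwo ν) f := by
  have : (FreeAlgebra.lift F θ).comp (piTwo F ν) = FreeAlgebra.lift F (θ ∘ varModTwo ν) := by
    ext x
    simp [piTwo]
  rw [← this]
  rfl

theorem lift_comp_algHom {X A B : Type*} [Ring A] [Algebra F A] [Ring B] [Algebra F B]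
    (α : A →ₐ[F] B) (φ : X → A) (f : FreeAlgebra F X) :
    FreeAlgebra.lift F (fun x => α (φ x)) f = α (FreeAlgebra.lift F φ f) := by
  have : FreeAlgebra.lift F (fun x => α (φ x)) = α.comp (FreeAlgebra.lift F φ) := by
    ext x
    simp
  rw [this]
  rfl

theorem component_le_modTwo (g : ℤ) :
    component F δ g ≤ component F (fun i => (δ i : ZMod 2)) (g : ZMod 2) := by
  refine Submodule.span_le.2 ?_
  rintro _ ⟨s, rfl, rfl⟩
  have := mono_mem_component (F := F) (fun i => (δ i : ZMod 2)) s
  rwa [← Int.cast_sum] at this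

/-- Both parities occur infinitely often in the two ℤ/2-gradings, so each embeds in the other by a
parity-preserving injection of generators, and injective graded maps reflect identities. -/
theorem gradedIdentities_eq_identitiesInfty [CharZero F]
    (hinf : ∀ i, {j | δ j = δ i}.Infinite) (hfull : FullSupport (component F δ))
    (heven : ∃ i, Even (δ i)) {ν : ℤ × ℕ → ℕ} (hν : Function.Injective (varModTwo ν)) :
    gradedIdentities (component F δ) = identitiesInfty F ν := by
  have hodd : ∃ i, Odd (δ i) := by
    by_contra! h
    -- An odd generator must exist, as degree 1 is a sum of generator degrees.
    obtain ⟨s, hs⟩ := exists_sum_eq hfull 1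
    have : Even (∑ i ∈ s, δ i) := Finset.even_sum _ fun i _ => Int.not_odd_iff_even.1 (h i)
    rw [hs] at this
    exact absurd this (by decide)
  have h0 : {i | (δ i : ZMod 2) = 0}.Infinite := by
    obtain ⟨i, hi⟩ := heven
    refine (hinf i).mono fun j hj => ?_
    change (δ j : ZMod 2) = 0
    rw [show δ j = δ i from hj]
    exact (ZMod.intCast_zmod_eq_zero_iff_dvd _ 2).2 hi.two_dvd
  have h1 : {i | (δ i : ZMod 2) = 1}.Infinite := by
    obtain ⟨i, k, hi⟩ := hodd
    refine (hinf i).mono fun j hj => ?_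
    change (δ j : ZMod 2) = 1
    rw [show δ j = δ i from hj, hi]
    push_cast
    rw [show (2 : ZMod 2) = 0 from rfl, zero_mul, zero_add]
  have h0' : {i : ℕ | (if Even i then (0 : ZMod 2) else 1) = 0}.Infinite := by
    refine (Set.infinite_range_of_injective (f := fun n : ℕ => 2 * n)
      fun m n h => by simpa using h).mono ?_
    rintro _ ⟨n, rfl⟩
    simp
  have h1' : {i : ℕ | (if Even i then (0 : ZMod 2) else 1) = 1}.Infinite := by
    refine (Set.infinite_range_of_injective (f := fun n : ℕ => 2 * n + 1)
      fun m n h => by simpa using h).mono ?_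
    rintro _ ⟨n, rfl⟩
    simp
  ext f
  constructor
  · intro hf θ hθ
    obtain ⟨α, hα, hmem⟩ := exists_injective_algHom_parity (F := F)
      (δ := fun i : ℕ => if Even i then (0 : ZMod 2) else 1) h0 h1
    apply hα
    rw [map_zero, lift_piTwo, ← lift_comp_algHom]
    exact gradedIdentities_subset_modTwo hinf hfull hf fun x =>
      hmem (x.1 : ZMod 2) _ (hθ (varModTwo ν x))
  · intro hf φ hφ
    obtain ⟨α, hα, hmem⟩ := exists_injective_algHom_parity (F := F)
      (δ := fun i => (δ i : ZMod 2)) h0' h1'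
    apply hα
    -- Injectivity of the renumbering makes the evaluation transfer; variables outside its range are
    -- sent to 0.
    have hext : Function.extend (varModTwo ν) (fun x => α (φ x)) 0 ∘ varModTwo ν =
        fun x => α (φ x) := funext fun x => hν.extend_apply _ _ _
    rw [map_zero, ← lift_comp_algHom, ← hext, ← lift_piTwo]
    refine hf _ fun y => ?_
    by_cases hy : ∃ x, varModTwo ν x = y
    · obtain ⟨x, rfl⟩ := hy
      rw [hν.extend_apply]
      exact hmem (x.1 : ZMod 2) _ (component_le_modTwo _ (hφ x))
    · rw [Function.extend_apply' _ _ _ hy]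
      exact zero_mem _

end EvenProduct

/-! ### Odd product: supercommutativity. -/

section OddProduct

variable {F : Type*} [Field F] {δ : ℕ → ℤ}

theorem even_card_iff_of_odd (hδ : ∀ i, Odd (δ i)) (s : Finset ℕ) :
    Even s.card ↔ Even (∑ i ∈ s, δ i) := by
  induction s using Finset.induction_on with
  | empty => simp
  | insert i s hi ih =>
    rw [Finset.card_insert_of_notMem hi, Finset.sum_insert hi, Nat.even_add_one, ih,
      Int.even_add, iff_false_left (Int.not_even_iff_odd.2 (hδ i))]

theorem mul_eq_of_mem_component {g h : ℤ} {c : F}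
    (hc : ∀ s t : Finset ℕ, ∑ i ∈ s, δ i = g → ∑ i ∈ t, δ i = h →
      (-1 : F) ^ (s.card * t.card) = c)
    {u v : Grassmann F} (hu : u ∈ component F δ g) (hv : v ∈ component F δ h) :
    u * v = c • (v * u) := by
  induction hu using Submodule.span_induction with
  | zero => simp
  | add u u' _ _ hu hu' => rw [add_mul, mul_add, hu, hu', smul_add]
  | smul d u _ hu => rw [smul_mul_assoc, mul_smul_comm, hu, smul_comm]
  | mem u hu =>
    obtain ⟨s, hs, rfl⟩ := hu
    induction hv using Submodule.span_induction with
    | zero => simp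
    | add v v' _ _ hv hv' => rw [add_mul, mul_add, hv, hv', smul_add]
    | smul d v _ hv => rw [smul_mul_assoc, mul_smul_comm, hv, smul_comm]
    | mem v hv =>
      obtain ⟨t, ht, rfl⟩ := hv
      rw [mono_eq_genProd, mono_eq_genProd, genProd_mul_genProd, Finset.length_sort,
        Finset.length_sort, hc s t hs ht]

theorem identitiesCan_subset (hδ : ∀ i, Odd (δ i)) :
    identitiesCan F ⊆ gradedIdentities (component F δ) := by
  rintro f (⟨g, h, hgh, rfl⟩ | ⟨g, h, ⟨hg, hh⟩, rfl⟩) φ hφ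
  · have := mul_eq_of_mem_component (c := 1) (fun s t hs ht => Even.neg_one_pow ?_)
      (hφ (g, 1)) (hφ (h, 2))
    · simpa [sub_eq_zero] using this
    · rw [Nat.even_mul, even_card_iff_of_odd hδ, even_card_iff_of_odd hδ, hs, ht]
      exact hgh
  · have := mul_eq_of_mem_component (c := -1) (fun s t hs ht => Odd.neg_one_pow ?_)
      (hφ (g, 1)) (hφ (h, 2))
    · simpa [← eq_neg_iff_add_eq_zero] using this
    · rw [← Nat.not_even_iff_odd, Nat.even_mul, even_card_iff_of_odd hδ, even_card_iff_of_odd hδ,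
        hs, ht, not_or]
      exact ⟨Int.not_even_iff_odd.2 hg, Int.not_even_iff_odd.2 hh⟩

/-! ### Consequences of the supercommutation relations. -/

section Quotient

variable {I : TwoSidedIdeal (FreeAlgebra F (ℤ × ℕ))}

/-- The defining identities only use the indices 1 and 2; degree-preserving renaming carries them to
arbitrary variables. -/
theorem exists_gradedEnd {x y : ℤ × ℕ} :
    ∃ α : FreeAlgebra F (ℤ × ℕ) →ₐ[F] FreeAlgebra F (ℤ × ℕ),
      (∀ g : ℤ, ∀ f ∈ freeComponent F g, α f ∈ freeComponent F g) ∧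
      α (FreeAlgebra.ι F (x.1, 1)) = FreeAlgebra.ι F x ∧
      α (FreeAlgebra.ι F (y.1, 2)) = FreeAlgebra.ι F y := by
  set σ : ℤ × ℕ → ℤ × ℕ := fun z => if z.2 = 1 then (z.1, x.2) else (z.1, y.2) with hσ
  have hσ1 : ∀ z, (σ z).1 = z.1 := fun z => by rw [hσ]; dsimp only; split_ifs <;> rfl
  refine ⟨FreeAlgebra.lift F fun z => FreeAlgebra.ι F (σ z), fun g f hf => ?_, ?_, ?_⟩
  · induction hf using Submodule.span_induction with
    | zero => simp
    | add u v _ _ hu hv => rw [map_add]; exact add_mem hu hv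
    | smul c u _ hu => rw [map_smul]; exact Submodule.smul_mem _ c hu
    | mem u hu =>
      obtain ⟨l, rfl, rfl⟩ := hu
      refine Submodule.subset_span ⟨l.map σ, ?_, ?_⟩
      · rw [List.map_map]
        exact congrArg List.sum (List.map_congr_left fun z _ => hσ1 z)
      · rw [map_list_prod, List.map_map, List.map_map]
        exact congrArg List.prod (List.map_congr_left fun z _ => FreeAlgebra.lift_ι_apply _ _)
  · rw [FreeAlgebra.lift_ι_apply]; simp [hσ]
  · rw [FreeAlgebra.lift_ι_apply]; simp [hσ]

theorem ι_mul_ι_sub_mem (hI : IsTIdeal F I) (hcan : ∀ f ∈ identitiesCan F, f ∈ I) {x y : ℤ × ℕ}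
    (h : Even x.1 ∨ Even y.1) : FreeAlgebra.ι F x * FreeAlgebra.ι F y -
      FreeAlgebra.ι F y * FreeAlgebra.ι F x ∈ I := by
  obtain ⟨α, hα, hx, hy⟩ := exists_gradedEnd (F := F) (x := x) (y := y)
  have := hI α hα _ (hcan _ (Or.inl ⟨x.1, y.1, h, rfl⟩))
  rwa [map_sub, map_mul, map_mul, hx, hy] at this

theorem ι_mul_ι_add_mem (hI : IsTIdeal F I) (hcan : ∀ f ∈ identitiesCan F, f ∈ I) {x y : ℤ × ℕ}
    (hx : Odd x.1) (hy : Odd y.1) : FreeAlgebra.ι F x * FreeAlgebra.ι F y +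
      FreeAlgebra.ι F y * FreeAlgebra.ι F x ∈ I := by
  obtain ⟨α, hα, hx', hy'⟩ := exists_gradedEnd (F := F) (x := x) (y := y)
  have := hI α hα _ (hcan _ (Or.inr ⟨x.1, y.1, ⟨hx, hy⟩, rfl⟩))
  rwa [map_add, map_mul, map_mul, hx', hy'] at this

variable (F) in
/-- The generic evaluation of the free graded algebra in the free supercommutative algebra. -/
def superEval : FreeAlgebra F (ℤ × ℕ) →ₐ[F] MvPolynomial (ℤ × ℕ) F ⊗[F] Grassmann F :=
  FreeAlgebra.lift F fun x => if Even x.1 then MvPolynomial.X x ⊗ₜ 1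
    else 1 ⊗ₜ gen F (Encodable.encode x)

/-- Modulo `I`, even variables are central and odd ones anticommute, hence have square zero as 2 is
invertible. The quotient map therefore factors through `superEval`. -/
theorem mem_of_superEval_eq_zero [CharZero F] (hI : IsTIdeal F I)
    (hcan : ∀ f ∈ identitiesCan F, f ∈ I) {f : FreeAlgebra F (ℤ × ℕ)} (hf : superEval F f = 0) :
    f ∈ I := by
  set Q := I.ringCon.Quotient
  set π : FreeAlgebra F (ℤ × ℕ) →ₐ[F] Q := I.ringCon.mkₐ (α := F)
  have hπ : ∀ a, π a = 0 ↔ a ∈ I := fun a => by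
    rw [TwoSidedIdeal.mem_iff]
    exact RingCon.eq (c := I.ringCon) (a := a) (b := 0)
  have hcomm : ∀ x y : ℤ × ℕ, (Even x.1 ∨ Even y.1) →
      π (FreeAlgebra.ι F x) * π (FreeAlgebra.ι F y) =
        π (FreeAlgebra.ι F y) * π (FreeAlgebra.ι F x) := fun x y h => by
    rw [← map_mul, ← map_mul, ← sub_eq_zero, ← map_sub, hπ]
    exact ι_mul_ι_sub_mem hI hcan h
  have hanti : ∀ x y : ℤ × ℕ, Odd x.1 → Odd y.1 →
      π (FreeAlgebra.ι F x) * π (FreeAlgebra.ι F y) =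
        -(π (FreeAlgebra.ι F y) * π (FreeAlgebra.ι F x)) := fun x y hx hy => by
    rw [← map_mul, ← map_mul, ← map_neg, ← sub_eq_zero, ← map_sub, hπ, sub_neg_eq_add]
    exact ι_mul_ι_add_mem hI hcan hx hy
  have hcenter : ∀ x : ℤ × ℕ, Even x.1 → π (FreeAlgebra.ι F x) ∈ Subalgebra.center F Q := by
    intro x hx
    rw [Subalgebra.mem_center_iff]
    intro b
    obtain ⟨a, rfl⟩ := I.ringCon.mkₐ_surjective (α := F) b
    change π a * _ = _ * π a
    induction a with
    | grade0 c => rw [AlgHom.commutes, Algebra.commutes]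
    | grade1 y => exact hcomm y x (Or.inr hx)
    | mul a b ha hb => rw [map_mul, mul_assoc, hb, ← mul_assoc, ha, mul_assoc]
    | add a b ha hb => rw [map_add, add_mul, mul_add, ha, hb]
  set P : MvPolynomial (ℤ × ℕ) F →ₐ[F] Subalgebra.center F Q :=
    MvPolynomial.aeval fun x => if hx : Even x.1 then ⟨π (FreeAlgebra.ι F x), hcenter x hx⟩ else 0
    with hP
  -- Generators that do not encode an odd variable go to 0, which keeps the relations intact.
  set t : ℕ → Q := fun n => match (Encodable.decode n : Option (ℤ × ℕ)) with
    | none => 0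
    | some x => if Odd x.1 then π (FreeAlgebra.ι F x) else 0 with ht
  have ht_cases : ∀ n, t n = 0 ∨ ∃ x : ℤ × ℕ, Odd x.1 ∧ t n = π (FreeAlgebra.ι F x) := by
    intro n
    rw [ht]
    dsimp only
    split
    · exact Or.inl rfl
    · rename_i x _
      split_ifs with h
      · exact Or.inr ⟨x, h, rfl⟩
      · exact Or.inl rfl
  have htanti : ∀ m n, t m * t n = -(t n * t m) := by
    intro m n
    rcases ht_cases m with h | ⟨x, hx, h⟩ <;> rcases ht_cases n with h' | ⟨y, hy, h'⟩ <;>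
      rw [h, h']
    · simp
    · simp
    · simp
    · exact hanti x y hx hy
  have htsq : ∀ n, t n * t n = 0 := by
    intro n
    have h := eq_neg_iff_add_eq_zero.1 (htanti n n)
    rw [← two_smul F, smul_eq_zero] at h
    exact h.resolve_left two_ne_zero
  have hcommP : ∀ (p : MvPolynomial (ℤ × ℕ) F) (u : Grassmann F),
      Commute (((Subalgebra.center F Q).val.comp P) p) (liftGen t htsq htanti u) :=
    fun p u => (Subalgebra.mem_center_iff.1 (P p).2 (liftGen t htsq htanti u)).symm
  set Ψ : MvPolynomial (ℤ × ℕ) F ⊗[F] Grassmann F →ₐ[F] Q :=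
    Algebra.TensorProduct.lift ((Subalgebra.center F Q).val.comp P) (liftGen t htsq htanti)
      hcommP with hΨ
  have hcomp : Ψ.comp (superEval F) = π := by
    ext x
    rw [Function.comp_apply, Function.comp_apply, AlgHom.comp_apply, superEval,
      FreeAlgebra.lift_ι_apply]
    split_ifs with hx
    · rw [hΨ, Algebra.TensorProduct.lift_tmul, map_one, mul_one, AlgHom.comp_apply, hP,
        MvPolynomial.aeval_X, dif_pos hx]
      rfl
    · rw [hΨ, Algebra.TensorProduct.lift_tmul, map_one, one_mul, liftGen_gen, ht]
      dsimp only
      rw [Encodable.encodek]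
      exact if_pos (Int.not_even_iff_odd.1 hx)
  rw [← hπ, ← hcomp, AlgHom.comp_apply, hf, map_zero]

end Quotient

/-- The specialization of the polynomial variables at the scalars `c`. -/
def scalarEval {X V : Type*} [Ring V] [Algebra F V] (c : X → F) :
    MvPolynomial X F ⊗[F] V →ₐ[F] V :=
  Algebra.TensorProduct.lift ((Algebra.ofId F V).comp (MvPolynomial.aeval c)) (AlgHom.id F V)
    fun a v => by
      rw [AlgHom.comp_apply]
      exact Algebra.commute_algebraMap_left (MvPolynomial.aeval c a) _

theorem scalarEval_tmul {X V : Type*} [Ring V] [Algebra F V] (c : X → F) (p : MvPolynomial X F)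
    (v : V) : scalarEval c (p ⊗ₜ[F] v) = MvPolynomial.eval c p • v := by
  rw [scalarEval, Algebra.TensorProduct.lift_tmul, AlgHom.comp_apply, Algebra.ofId_apply,
    ← Algebra.smul_def, AlgHom.id_apply, MvPolynomial.aeval_eq_eval]

/-- Coordinates in a basis of `V` are polynomials over an infinite field that vanish at every point.
-/
theorem eq_zero_of_scalarEval_eq_zero [Infinite F] {X V : Type*} [Ring V] [Algebra F V]
    {u : MvPolynomial X F ⊗[F] V} (h : ∀ c : X → F, scalarEval c u = 0) : u = 0 := by
  let b := Module.Basis.ofVectorSpace F V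
  refine (Algebra.TensorProduct.basis (MvPolynomial X F) b).ext_elem fun i => ?_
  rw [map_zero, Finsupp.zero_apply]
  refine MvPolynomial.funext fun c => ?_
  have key : ∀ w : MvPolynomial X F ⊗[F] V,
      MvPolynomial.eval c ((Algebra.TensorProduct.basis (MvPolynomial X F) b).repr w i) =
        b.repr (scalarEval c w) i := by
    intro w
    induction w with
    | zero => simp
    | add w w' hw hw' => simp only [map_add, Finsupp.add_apply, hw, hw']
    | tmul p v =>
      rw [Algebra.TensorProduct.basis_repr_tmul, scalarEval_tmul]
      simp
  rw [key, h c]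
  simp

/-- Each scalar specialization sends even variables to scalars and odd variables to generators. This
is admissible for the grading mod 2, though in general not for the ℤ-grading, hence the need for
coarsening. -/
theorem superEval_eq_zero [CharZero F] (hinf : ∀ i, {j | δ j = δ i}.Infinite)
    (hfull : FullSupport (component F δ)) (hδ : ∀ i, Odd (δ i)) {f : FreeAlgebra F (ℤ × ℕ)}
    (hf : f ∈ gradedIdentities (component F δ)) : superEval F f = 0 := by
  refine eq_zero_of_scalarEval_eq_zero fun c => ?_
  rw [superEval, ← lift_comp_algHom]
  refine gradedIdentities_subset_modTwo hinf hfull hf fun x => ?_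
  split_ifs with hx
  · rw [scalarEval_tmul, (ZMod.intCast_zmod_eq_zero_iff_dvd _ 2).2 hx.two_dvd]
    exact Submodule.smul_mem _ _ (one_mem_component _)
  · rw [scalarEval_tmul, map_one, one_smul]
    have hcast : ∀ z : ℤ, Odd z → (z : ZMod 2) = 1 := by
      rintro _ ⟨k, rfl⟩
      push_cast
      rw [show (2 : ZMod 2) = 0 from rfl, zero_mul, zero_add]
    have := gen_mem_component (F := F) (fun i => (δ i : ZMod 2)) (Encodable.encode x)
    rwa [hcast _ (hδ _), ← hcast _ (Int.not_even_iff_odd.1 hx)] at this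

end OddProduct

end GrassmannGrading

end

theorem mainTheorem6 {F : Type*} [Field F] [CharZero F] (a b c : ℤ) (ha : 0 < a) (hb : 0 < b)
    (hbc : -b < c) (hca : c < a) (δ : ℕ → ℤ)
    (hδ : GrassmannGrading.IsInduced ![-b, c, a] ![⊤, ⊤, ⊤] δ)
    (hfull : GrassmannGrading.FullSupport (GrassmannGrading.component F δ))
    (ν : ℤ × ℕ → ℕ) (hν : Function.Injective (GrassmannGrading.varModTwo ν)) :
    GrassmannGrading.IsDCentral 2 (GrassmannGrading.component F δ) ∧
    (Even (a * b * c) → GrassmannGrading.GeneratesVariety (GrassmannGrading.component F δ)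
      (GrassmannGrading.identitiesInfty F ν)) ∧
    (Odd (a * b * c) → GrassmannGrading.GeneratesVariety (GrassmannGrading.component F δ)
      (GrassmannGrading.identitiesCan F)) := by
  have htop : ∀ j : Fin 3, (![⊤, ⊤, ⊤] : Fin 3 → ℕ∞) j = ⊤ := by
    intro j
    fin_cases j <;> rfl
  have hinf' : ∀ j : Fin 3, {i | δ i = ![-b, c, a] j}.Infinite := fun j =>
    Set.encard_eq_top_iff.1 ((hδ.encard_eq j).trans (htop j))
  have hinf : ∀ i, {j | δ j = δ i}.Infinite := fun i => by
    obtain ⟨j, hj⟩ := hδ.mem_range i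
    rw [hj]
    exact hinf' j
  refine ⟨GrassmannGrading.isDCentral_two_component hinf hfull, fun habc => ?_, fun habc => ?_⟩
  · have heven : ∃ i, Even (δ i) := by
      have : ∃ j, Even (![-b, c, a] j) := by
        rw [Int.even_mul, Int.even_mul] at habc
        rcases habc with (h | h) | h
        · exact ⟨2, h⟩
        · exact ⟨0, h.neg⟩
        · exact ⟨1, h⟩
      obtain ⟨j, hj⟩ := this
      obtain ⟨i, hi⟩ := (hinf' j).nonempty
      exact ⟨i, by rwa [show δ i = _ from hi]⟩
    have h := GrassmannGrading.gradedIdentities_eq_identitiesInfty hinf hfull heven hν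
    -- The defining set already is the full set of identities, so it lies in every ideal that
    -- contains it.
    exact Set.Subset.antisymm (fun f hf I _ hI => hI f (h ▸ hf))
      (GrassmannGrading.tIdealGenerated_subset _ h.ge)
  · have hodd : ∀ i, Odd (δ i) := by
      intro i
      rw [Int.odd_mul, Int.odd_mul] at habc
      obtain ⟨j, hj⟩ := hδ.mem_range i
      rw [hj]
      fin_cases j
      · exact habc.1.2.neg
      · exact habc.2
      · exact habc.1.1
    exact Set.Subset.antisymm (fun f hf I hI hcan =>
        GrassmannGrading.mem_of_superEval_eq_zero hI hcan
          (GrassmannGrading.superEval_eq_zero hinf hfull hodd hf))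
      (GrassmannGrading.tIdealGenerated_subset _ (GrassmannGrading.identitiesCan_subset hodd))
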